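/- Let $d\ge 2$ and let $\Lambda$ be a finite collection of plaquettes (unit two-cells) of the cubical lattice $\mathbb Z^d$, regarded as a cell complex: a site or bond belongs to a collection of plaquettes if it lies on one of them, and a cube or higher cell belongs to it if all its plaquettes do. Let $J_{ij}\neq 0$ be real couplings on the bonds of $\Lambda$, with signs $\hat J_{ij}$; a plaquette $p$ is frustrated if $\phi(\partial p)=\prod_{\langle i,j\rangle\subset p}\hat J_{ij}=-1$ and unfrustrated if $\phi(\partial p)=1$. Let $\mathcal N_-$ be a collection of frustrated and $\mathcal N_+$ a collection of unfrustrated plaquettes of $\Lambda$, such that every plaquette of $\Lambda$ which touches (shares a site with) a plaquette of $\mathcal N_-\cup\mathcal N_+$ belongs to $\mathcal N_-\cup\mathcal N_+$ (for example $\Lambda=\mathcal N_-\cup\mathcal N_+$; or $\mathcal N_-$ consists of all the frustrated plaquettes and $\mathcal N_+$ of all the connected unfrustrated networks touching $\mathcal N_-$). For a $k$-cell $\sigma$ let $\sigma^*$ be the dual $(d-k)$-cell of the dual lattice $(\mathbb Z+\tfrac12)^d$. For a set $A$ of cells, let $A^*$ be the complex formed by the closed cells $\sigma^*$, $\sigma\in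 A$, and let $\partial A^*$ be the set of the cells of $A^*$ that are not dual to a cell of $A$. This defines $\mathcal N_+^*,\partial\mathcal N_+^*,\partial\Lambda^*$; by $\mathcal N_-^*$ and $\partial\mathcal N_-^*$ we mean $A^*$ and $\partial A^*$ for the set $A$ of the cells of $\mathcal N_-\cup\mathcal N_+$ that do not belong to $\mathcal N_+$. Let $$\partial^*:H^1(\mathcal N_+;\mathbb Z_2)\to H^2(\mathcal N_-\cup\mathcal N_+,\mathcal N_+;\mathbb Z_2)$$ be the coboundary map of the pair (extend a cocycle by zero and take its coboundary), and let $$\partial:H_{d-1}(\mathcal N_+^*,\partial\mathcal N_+^*;\mathbb Z_2)\to H_{d-2}(\mathcal N_-^*,\partial\mathcal N_-^*\cap\partial\Lambda^*;\mathbb Z_2)$$ be the boundary map, which sends $[\Sigma]$ to the class of the part of $\partial\Sigma$ outside $\partial\Lambda^*$. Then sending a cocycle $\sum_\sigma a_\sigma\,\sigma$ to the chain $\sum_\sigma a_\sigma\,\sigma^*$ of the dual cells induces isomorphisms $$H^1(\mathcal N_+;\mathbb Z_2)\cong H_{d-1}(\mathcal N_+^*,\partial\mathcal N_+^*;\mathbb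 Z_2),\qquad H^2(\mathcal N_-\cup\mathcal N_+,\mathcal N_+;\mathbb Z_2)\cong H_{d-2}(\mathcal N_-^*,\partial\mathcal N_-^*\cap\partial\Lambda^*;\mathbb Z_2),$$ and with these isomorphisms as vertical maps the diagram $$\begin{array}{ccc} H^1(\mathcal N_+;\mathbb Z_2)&\xrightarrow{\ \partial^*\ }&H^2(\mathcal N_-\cup\mathcal N_+,\mathcal N_+;\mathbb Z_2)\\ \downarrow\cong&&\downarrow\cong\\ H_{d-1}(\mathcal N_+^*,\partial\mathcal N_+^*;\mathbb Z_2)&\xrightarrow{\ \partial\ }&H_{d-2}(\mathcal N_-^*,\partial\mathcal N_-^*\cap\partial\Lambda^*;\mathbb Z_2) \end{array}$$ commutes. In particular, for every spin configuration $\sigma_i=\pm1$, if $\Sigma$ is the sum of the $(d-1)$-cells dual to the bonds $\langle i,j\rangle$ of $\mathcal N_+$ with $\hat J_{ij}\sigma_i\sigma_j=-1$ (the domain walls on $\mathcal N_+$) and $\Gamma$ is the sum of the $(d-2)$-cells dual to the plaquettes of $\mathcal N_-$, then $\partial[\Sigma]=[\Gamma]$. -/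

import Mathlib

open Finset

noncomputable section

namespace SpinGlass

/-! ### Cells of the cubical lattice -/

/-- A cell of the decomposition of `ℝ^d` into unit cubes with vertex set `ℤ^d`, recorded by twice
its centre: `c` stands for the product over `i` of the point `{c i / 2}` if `c i` is even and of the
unit interval `[(c i - 1) / 2, (c i + 1) / 2]` if `c i` is odd. -/
abbrev Cell (d : ℕ) := Fin d → ℤ

variable {d : ℕ}

/-- The dimension of a cell. -/
def dim (c : Cell d) : ℕ := (univ.filter fun i => Odd (c i)).card

/-- `IsFace τ σ`: the (closed) cell `τ` is contained in the (closed) cell `σ`. -/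
def IsFace (τ σ : Cell d) : Prop :=
  ∀ i, τ i = σ i ∨ (Odd (σ i) ∧ (τ i = σ i - 1 ∨ τ i = σ i + 1))

/-- The codimension one faces of a cell. -/
def facets (σ : Cell d) : Finset (Cell d) :=
  (univ.filter fun i => Odd (σ i)).biUnion fun i =>
    {Function.update σ i (σ i - 1), Function.update σ i (σ i + 1)}

/-- A set of cells that is closed under taking faces. -/
def IsSubcomplex (K : Set (Cell d)) : Prop := ∀ σ ∈ K, ∀ τ, IsFace τ σ → τ ∈ K

/-- The cell of the dual lattice dual to a given cell. The dual lattice `(ℤ + 1/2)^d` is carried to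
`ℤ^d` by adding `1/2` to every coordinate, which adds `1` to every doubled coordinate: the dual cell
has the same centre and extends in the complementary directions. -/
def dual (c : Cell d) : Cell d := fun i => c i + 1

theorem IsFace.refl (σ : Cell d) : IsFace σ σ := fun _ => Or.inl rfl

theorem IsFace.trans {ρ τ σ : Cell d} (h₁ : IsFace ρ τ) (h₂ : IsFace τ σ) : IsFace ρ σ := by
  intro i
  rcases h₁ i with h | ⟨ho, h⟩ <;> rcases h₂ i with h' | ⟨ho', h'⟩
  · exact Or.inl (h.trans h')
  · exact Or.inr ⟨ho', by omega⟩
  · exact Or.inr ⟨h' ▸ ho, by omega⟩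
  · exfalso
    rw [Int.odd_iff] at ho ho'
    omega

theorem isFace_of_mem_facets {τ σ : Cell d} (h : τ ∈ facets σ) : IsFace τ σ := by
  simp only [facets, mem_biUnion, mem_filter, mem_univ, true_and, mem_insert, mem_singleton] at h
  obtain ⟨i, hi, h⟩ := h
  intro j
  by_cases hj : j = i
  · subst hj
    rcases h with rfl | rfl <;> simp [hi]
  · rcases h with rfl | rfl <;> simp [hj]

theorem dim_of_mem_facets {τ σ : Cell d} (h : τ ∈ facets σ) : dim τ + 1 = dim σ := by
  simp only [facets, mem_biUnion, mem_filter, mem_univ, true_and, mem_insert, mem_singleton] at h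
  obtain ⟨i, hi, h⟩ := h
  have : (univ.filter fun j => Odd (τ j)) = (univ.filter fun j => Odd (σ j)).erase i := by
    ext j
    simp only [mem_filter, mem_univ, true_and, mem_erase]
    by_cases hj : j = i
    · subst hj
      rcases h with rfl | rfl <;> simp [Int.odd_iff] at hi ⊢ <;> omega
    · rcases h with rfl | rfl <;> simp [hj]
  rw [dim, dim, this]
  exact card_erase_add_one (by simpa using hi)

theorem isFace_dual {τ σ : Cell d} : IsFace (dual σ) (dual τ) ↔ IsFace τ σ := by
  refine forall_congr' fun i => ?_
  simp only [dual, Int.odd_iff]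
  omega

theorem dual_surjective : Function.Surjective (dual : Cell d → Cell d) := fun c =>
  ⟨fun i => c i - 1, by ext i; simp [dual]⟩

theorem dual_injective : Function.Injective (dual : Cell d → Cell d) := fun a b h => by
  ext i; simpa [dual] using congrFun h i

theorem sum_facets {M : Type*} [AddCommMonoid M] (σ : Cell d) (f : Cell d → M) :
    ∑ τ ∈ facets σ, f τ = ∑ i ∈ univ.filter (fun i => Odd (σ i)),
      (f (Function.update σ i (σ i - 1)) + f (Function.update σ i (σ i + 1))) := by
  rw [facets, sum_biUnion]
  · refine sum_congr rfl fun i _ => sum_pair fun h => ?_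
    have := congrFun h i
    simp at this
    omega
  · intro i _ j _ hij
    rw [Function.onFun, disjoint_left]
    intro a ha hb
    simp only [mem_insert, mem_singleton] at ha hb
    have h1 : a i ≠ σ i := by rcases ha with rfl | rfl <;> simp
    apply h1
    rcases hb with rfl | rfl <;> simp [hij]

/-- The identity `∂∂ = 0` with coefficients mod 2. -/
theorem sum_facets_facets {M : Type*} [AddCommGroup M] [Module (ZMod 2) M] (σ : Cell d)
    (f : Cell d → M) : ∑ τ ∈ facets σ, ∑ ρ ∈ facets τ, f ρ = 0 := by
  have two : ∀ m : M, m + m = 0 := fun m => by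
    have : (1 + 1 : ZMod 2) • m = 0 := by
      rw [show (1 + 1 : ZMod 2) = 0 from rfl, zero_smul]
    simpa [add_smul] using this
  have key : ∀ i, Odd (σ i) → ∀ s : ℤ, (s = σ i - 1 ∨ s = σ i + 1) →
      ∑ ρ ∈ facets (Function.update σ i s), f ρ =
        ∑ j ∈ (univ.filter fun j => Odd (σ j)).erase i,
          (f (Function.update (Function.update σ i s) j (σ j - 1)) +
            f (Function.update (Function.update σ i s) j (σ j + 1))) := by
    intro i hi s hs
    rw [sum_facets]
    refine sum_congr ?_ fun j hj => ?_
    · ext j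
      simp only [mem_filter, mem_univ, true_and, mem_erase]
      by_cases hj : j = i
      · subst hj
        simp only [Function.update_self, Int.odd_iff] at hi ⊢
        omega
      · simp [hj]
    · have : j ≠ i := by rintro rfl; simp at hj
      simp [this]
  rw [sum_facets]
  have : ∀ i ∈ univ.filter (fun i => Odd (σ i)),
      (∑ ρ ∈ facets (Function.update σ i (σ i - 1)), f ρ +
        ∑ ρ ∈ facets (Function.update σ i (σ i + 1)), f ρ) =
      ∑ j ∈ (univ.filter fun j => Odd (σ j)).erase i,
        ((f (Function.update (Function.update σ i (σ i - 1)) j (σ j - 1)) +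
            f (Function.update (Function.update σ i (σ i - 1)) j (σ j + 1))) +
          (f (Function.update (Function.update σ i (σ i + 1)) j (σ j - 1)) +
            f (Function.update (Function.update σ i (σ i + 1)) j (σ j + 1)))) := by
    intro i hi
    have hi' : Odd (σ i) := by simpa using hi
    rw [key i hi' _ (Or.inl rfl), key i hi' _ (Or.inr rfl), ← sum_add_distrib]
  rw [sum_congr rfl this, sum_sigma']
  refine sum_involution (fun a _ => ⟨a.2, a.1⟩) ?_ ?_ ?_ ?_
  · rintro ⟨i, j⟩ h
    have hne : j ≠ i := by
      simp only [mem_sigma, mem_erase] at h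
      exact h.2.1
    simp only [Function.update_comm hne]
    have h4 : ∀ a b c e : M, a + b + (c + e) + (a + c + (b + e)) = 0 := by
      intro a b c e
      have : a + b + (c + e) + (a + c + (b + e)) = (a + a) + (b + b) + (c + c) + (e + e) := by
        abel
      simp only [this, two]
    exact h4 _ _ _ _
  · rintro ⟨i, j⟩ h _ heq
    simp only [mem_sigma, mem_erase] at h
    exact h.2.1 (congrArg Sigma.fst heq)
  · rintro ⟨i, j⟩ h
    simp only [mem_sigma, mem_erase] at h ⊢
    exact ⟨h.2.2, Ne.symm h.2.1, h.1⟩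
  · intros; rfl

/-! ### Subquotients -/

section Subquotient

variable {R M M' : Type*} [Ring R] [AddCommGroup M] [Module R M] [AddCommGroup M'] [Module R M']

/-- The quotient `Z / (B ∩ Z)` for submodules `Z` and `B` of a module. -/
def Subquotient (Z B : Submodule R M) : Type _ := Z ⧸ B.submoduleOf Z

instance (Z B : Submodule R M) : AddCommGroup (Subquotient Z B) :=
  inferInstanceAs (AddCommGroup (Z ⧸ B.submoduleOf Z))

instance (Z B : Submodule R M) : Module R (Subquotient Z B) :=
  inferInstanceAs (Module R (Z ⧸ B.submoduleOf Z))

/-- The class of an element of `Z` in `Z / (B ∩ Z)`. -/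
def Subquotient.mk {Z B : Submodule R M} (x : M) (hx : x ∈ Z) : Subquotient Z B :=
  (B.submoduleOf Z).mkQ ⟨x, hx⟩

/-- The map of subquotients `[x] ↦ [f x]` induced by a linear map. -/
def Subquotient.map {Z B : Submodule R M} {Z' B' : Submodule R M'} (f : M →ₗ[R] M')
    (hZ : ∀ x ∈ Z, f x ∈ Z') (hB : ∀ x ∈ Z, x ∈ B → f x ∈ B') :
    Subquotient Z B →ₗ[R] Subquotient Z' B' :=
  (B.submoduleOf Z).mapQ (B'.submoduleOf Z') (f.restrict hZ) fun x hx => hB x x.2 hx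

end Subquotient

/-! ### Relative homology with coefficients in `ℤ/2` -/

/-- The chains with coefficients in `ℤ/2`, in all degrees together. -/
abbrev Chain (d : ℕ) := Cell d →₀ ZMod 2

/-- The cellular boundary operator `∂`. -/
def boundary : Chain d →ₗ[ZMod 2] Chain d :=
  Finsupp.linearCombination (ZMod 2) fun σ => ∑ τ ∈ facets σ, Finsupp.single τ 1

/-- `C_k(K; ℤ/2)`. -/
def chains (K : Set (Cell d)) (k : ℕ) : Submodule (ZMod 2) (Chain d) :=
  Finsupp.supported (ZMod 2) (ZMod 2) {c | c ∈ K ∧ dim c = k}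

/-- The relative cycles `Z_k(K, L; ℤ/2)`: the `k`-chains of `K` whose boundary lies in `L`. -/
def cycles (K L : Set (Cell d)) (k : ℕ) : Submodule (ZMod 2) (Chain d) :=
  chains K k ⊓ (Finsupp.supported (ZMod 2) (ZMod 2) L).comap boundary

/-- The relative boundaries `B_k(K, L; ℤ/2)`: the boundaries of `(k+1)`-chains of `K`, up to
`k`-chains of `L`. -/
def boundaries (K L : Set (Cell d)) (k : ℕ) : Submodule (ZMod 2) (Chain d) :=
  (chains K (k + 1)).map boundary ⊔ chains L k

/-- The relative homology `H_k(K, L; ℤ/2)` of subcomplexes `L ⊆ K`. -/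
abbrev Homology (K L : Set (Cell d)) (k : ℕ) : Type :=
  Subquotient (cycles K L k) (boundaries K L k)

/-! ### Relative cohomology with coefficients in `ℤ/2` -/

/-- `C^k(K, L; ℤ/2)`: the functions on the `k`-cells of `K` that vanish on the cells of `L`. Such a
function is extended by zero to all cells. -/
def cochains (K L : Set (Cell d)) (k : ℕ) : Submodule (ZMod 2) (Cell d → ZMod 2) where
  carrier := {f | ∀ c, ¬ (c ∈ K ∧ c ∉ L ∧ dim c = k) → f c = 0}
  zero_mem' := fun _ _ => rfl
  add_mem' := fun hf hg c hc => by simp [hf c hc, hg c hc]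
  smul_mem' := fun a f hf c hc => by simp [hf c hc]

/-- The coboundary operator of `K`, adjoint to the boundary operator:
`(∂^* f)(σ) = f(∂σ)` for the cells `σ` of `K`. -/
def coboundary (K : Set (Cell d)) : (Cell d → ZMod 2) →ₗ[ZMod 2] (Cell d → ZMod 2) where
  toFun f := K.indicator fun σ => ∑ τ ∈ facets σ, f τ
  map_add' f g := by
    ext σ
    by_cases h : σ ∈ K <;> simp [h, sum_add_distrib]
  map_smul' a f := by
    ext σ
    by_cases h : σ ∈ K <;> simp [h, mul_sum]

theorem coboundary_apply (K : Set (Cell d)) (f : Cell d → ZMod 2) (σ : Cell d) :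
    coboundary K f σ = K.indicator (fun σ => ∑ τ ∈ facets σ, f τ) σ := rfl

/-- The relative cocycles `Z^k(K, L; ℤ/2)`. -/
def cocycles (K L : Set (Cell d)) (k : ℕ) : Submodule (ZMod 2) (Cell d → ZMod 2) :=
  cochains K L k ⊓ LinearMap.ker (coboundary K)

/-- The relative coboundaries `B^k(K, L; ℤ/2)`. -/
def coboundaries (K L : Set (Cell d)) : ℕ → Submodule (ZMod 2) (Cell d → ZMod 2)
  | 0 => ⊥
  | k + 1 => (cochains K L k).map (coboundary K)

/-- The relative cohomology `H^k(K, L; ℤ/2)` of subcomplexes `L ⊆ K`. -/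
abbrev Cohomology (K L : Set (Cell d)) (k : ℕ) : Type :=
  Subquotient (cocycles K L k) (coboundaries K L k)

/-! ### The coboundary map in cohomology -/

theorem coboundary_coboundary {K : Set (Cell d)} (hK : IsSubcomplex K) (f : Cell d → ZMod 2) :
    coboundary K (coboundary K f) = 0 := by
  ext σ
  rw [coboundary_apply]
  by_cases hσ : σ ∈ K
  · rw [Set.indicator_of_mem hσ, Pi.zero_apply, ← sum_facets_facets σ f]
    refine sum_congr rfl fun τ hτ => ?_
    rw [coboundary_apply, Set.indicator_of_mem (hK σ hσ τ (isFace_of_mem_facets hτ))]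
  · rw [Set.indicator_of_notMem hσ, Pi.zero_apply]

theorem coboundary_eq_of_mem {K L : Set (Cell d)} (hLK : L ⊆ K) (f : Cell d → ZMod 2) {σ : Cell d}
    (hσ : σ ∈ L) : coboundary K f σ = coboundary L f σ := by
  rw [coboundary_apply, coboundary_apply, Set.indicator_of_mem hσ, Set.indicator_of_mem (hLK hσ)]

theorem coboundary_degree {K : Set (Cell d)} {f : Cell d → ZMod 2} {k : ℕ}
    (hf : ∀ c, dim c ≠ k → f c = 0) {σ : Cell d} (h : ¬ (σ ∈ K ∧ dim σ = k + 1)) :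
    coboundary K f σ = 0 := by
  rw [coboundary_apply]
  by_cases hσ : σ ∈ K
  · rw [Set.indicator_of_mem hσ]
    refine sum_eq_zero fun τ hτ => hf τ ?_
    have := dim_of_mem_facets hτ
    intro hk
    exact h ⟨hσ, by omega⟩
  · rw [Set.indicator_of_notMem hσ]

theorem coboundary_mem_cocycles {K L : Set (Cell d)} (hLK : L ⊆ K) (hK : IsSubcomplex K) {k : ℕ}
    {f : Cell d → ZMod 2} (hf : f ∈ cocycles L ∅ k) : coboundary K f ∈ cocycles K L (k + 1) := by
  refine ⟨fun c hc => ?_, coboundary_coboundary hK f⟩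
  by_cases hL : c ∈ L
  · rw [coboundary_eq_of_mem hLK f hL, show coboundary L f = 0 from hf.2]; rfl
  · refine coboundary_degree (k := k) (fun c hc => hf.1 c fun h => hc h.2.2) fun h => hc ⟨h.1, hL, h.2⟩

/-- The coboundary map `∂^* : H^k(L; ℤ/2) → H^{k+1}(K, L; ℤ/2)` of the pair `L ⊆ K`: a cocycle of
`L` is extended by zero to a cochain of `K`, of which one takes the coboundary. -/
def coboundaryMap {K L : Set (Cell d)} (hLK : L ⊆ K) (hK : IsSubcomplex K) (k : ℕ) :
    Cohomology L ∅ k →ₗ[ZMod 2] Cohomology K L (k + 1) :=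
  Subquotient.map (coboundary K) (fun _ hf => coboundary_mem_cocycles hLK hK hf) <| by
    intro f hf hB
    cases k with
    | zero =>
      obtain rfl : f = 0 := hB
      rw [map_zero]; exact Submodule.zero_mem _
    | succ k =>
      obtain ⟨g, hg, rfl⟩ := hB
      refine ⟨coboundary L g - coboundary K g, fun c hc => ?_, ?_⟩
      · rw [Pi.sub_apply]
        by_cases hL : c ∈ L
        · rw [coboundary_eq_of_mem hLK g hL, sub_self]
        · rw [coboundary_degree (K := L) (k := k) (fun c hc => hg c fun h => hc h.2.2)
              (fun h => hL h.1),
            coboundary_degree (K := K) (k := k) (fun c hc => hg c fun h => hc h.2.2)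
              (fun h => hc ⟨h.1, hL, h.2⟩), sub_self]
      · rw [map_sub, coboundary_coboundary hK, sub_zero]

/-! ### The boundary map in homology -/

theorem boundary_single (σ : Cell d) :
    boundary (Finsupp.single σ 1) = ∑ τ ∈ facets σ, Finsupp.single τ (1 : ZMod 2) := by
  simp [boundary, Finsupp.linearCombination_single]

theorem boundary_mem_supported {S T : Set (Cell d)} (h : ∀ σ ∈ S, ∀ τ ∈ facets σ, τ ∈ T)
    {x : Chain d} (hx : x ∈ Finsupp.supported (ZMod 2) (ZMod 2) S) :
    boundary x ∈ Finsupp.supported (ZMod 2) (ZMod 2) T := by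
  rw [Finsupp.supported_eq_span_single] at hx
  refine (Submodule.span_le (p := (Finsupp.supported (ZMod 2) (ZMod 2) T).comap boundary)).2 ?_ hx
  rintro _ ⟨σ, hσ, rfl⟩
  rw [SetLike.mem_coe, Submodule.mem_comap]
  rw [boundary_single]
  exact Submodule.sum_mem _ fun τ hτ => Finsupp.single_mem_supported _ _ (h σ hσ τ hτ)

theorem boundary_boundary (x : Chain d) : boundary (boundary x) = 0 := by
  have : (boundary ∘ₗ boundary : Chain d →ₗ[ZMod 2] Chain d) = 0 := by
    refine Finsupp.lhom_ext' fun σ => LinearMap.ext_ring ?_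
    simp only [LinearMap.comp_apply, Finsupp.lsingle_apply, boundary_single, map_sum,
      sum_facets_facets, LinearMap.zero_apply]
  exact LinearMap.congr_fun this x

/-- The part of a chain that consists of the cells outside `D`. -/
def offPart (D : Set (Cell d)) : Chain d →ₗ[ZMod 2] Chain d :=
  (Finsupp.supported (ZMod 2) (ZMod 2) Dᶜ).subtype ∘ₗ
    (by classical exact Finsupp.restrictDom (ZMod 2) (ZMod 2) Dᶜ)

theorem offPart_apply_of_mem {D : Set (Cell d)} {c : Cell d} (h : c ∈ D) (x : Chain d) :
    offPart D x c = 0 := by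
  classical
  simp [offPart, Finsupp.restrictDom_apply, h]

theorem offPart_apply_of_notMem {D : Set (Cell d)} {c : Cell d} (h : c ∉ D) (x : Chain d) :
    offPart D x c = x c := by
  classical
  simp [offPart, Finsupp.restrictDom_apply, h]

theorem chains_le {K : Set (Cell d)} {k : ℕ} :
    chains K k ≤ Finsupp.supported (ZMod 2) (ZMod 2) K :=
  Finsupp.supported_mono fun _ h => h.1

theorem boundary_mem_of_isSubcomplex {K : Set (Cell d)} (hK : IsSubcomplex K) {x : Chain d}
    (hx : x ∈ Finsupp.supported (ZMod 2) (ZMod 2) K) :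
    boundary x ∈ Finsupp.supported (ZMod 2) (ZMod 2) K :=
  boundary_mem_supported (fun σ hσ τ hτ => hK σ hσ τ (isFace_of_mem_facets hτ)) hx

theorem boundary_mem_dim {S : Set (Cell d)} {k : ℕ} {x : Chain d} (hx : x ∈ chains S (k + 1)) :
    boundary x ∈ Finsupp.supported (ZMod 2) (ZMod 2) {c : Cell d | dim c = k} :=
  boundary_mem_supported (S := {c | c ∈ S ∧ dim c = k + 1}) (fun σ hσ τ hτ => by
    have := dim_of_mem_facets hτ
    have := hσ.2
    change dim τ = k
    omega) hx

/-- `y = offPart D y + (y - offPart D y)`, where the second summand lies in `D`. -/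
theorem sub_offPart_mem {D T : Set (Cell d)} {y : Chain d}
    (hy : y ∈ Finsupp.supported (ZMod 2) (ZMod 2) T) :
    y - offPart D y ∈ Finsupp.supported (ZMod 2) (ZMod 2) (T ∩ D) := by
  rw [Finsupp.mem_supported'] at hy ⊢
  intro c hc
  rw [Finsupp.sub_apply]
  by_cases h : c ∈ D
  · rw [offPart_apply_of_mem h, sub_zero]
    exact hy c fun h' => hc ⟨h', h⟩
  · rw [offPart_apply_of_notMem h, sub_self]

theorem offPart_mem {D T T' : Set (Cell d)} (hT : T \ D ⊆ T') {y : Chain d}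
    (hy : y ∈ Finsupp.supported (ZMod 2) (ZMod 2) T) :
    offPart D y ∈ Finsupp.supported (ZMod 2) (ZMod 2) T' := by
  rw [Finsupp.mem_supported'] at hy ⊢
  intro c hc
  by_cases h : c ∈ D
  · rw [offPart_apply_of_mem h]
  · rw [offPart_apply_of_notMem h]
    exact hy c fun h' => hc (hT ⟨h', h⟩)

theorem offPart_eq_zero {D : Set (Cell d)} {y : Chain d}
    (hy : y ∈ Finsupp.supported (ZMod 2) (ZMod 2) D) : offPart D y = 0 := by
  rw [Finsupp.mem_supported'] at hy
  ext c
  by_cases h : c ∈ D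
  · rw [offPart_apply_of_mem h]; rfl
  · rw [offPart_apply_of_notMem h, hy c h]; rfl

/-- The boundary map `H_{k+1}(K, L; ℤ/2) → H_k(M, Q; ℤ/2)`, where `L` is contained in the
union of `M` and of a subcomplex `D`, and `Q = M ∩ D` (only one inclusion is needed here): the class of a relative cycle `Σ` goes
to the class of the part of `∂Σ` outside `D`. This is the connecting map
`H_{k+1}(K, L) → H_k(L)` followed by the map to `H_k(M ∪ D, D)` and by the excision isomorphism
`H_k(M ∪ D, D) = H_k(M, M ∩ D)`. -/
def boundaryMap {K L M Q D : Set (Cell d)} (hM : IsSubcomplex M) (hD : IsSubcomplex D)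
    (hL : L ⊆ M ∪ D) (hQ : M ∩ D ⊆ Q) {k l : ℕ} (hkl : k + 1 = l) :
    Homology K L l →ₗ[ZMod 2] Homology M Q k :=
  Subquotient.map (offPart D ∘ₗ boundary)
    (by
      intro x hx
      subst hkl
      have hx2 : boundary x ∈ Finsupp.supported (ZMod 2) (ZMod 2) L := hx.2
      have hLM : L \ D ⊆ M := fun c hc => (hL hc.1).resolve_right hc.2
      have h1 : offPart D (boundary x) ∈ Finsupp.supported (ZMod 2) (ZMod 2) M :=
        offPart_mem hLM hx2
      have hdim := boundary_mem_dim hx.1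
      refine ⟨?_, ?_⟩
      · rw [LinearMap.comp_apply]
        refine offPart_mem (T := L ∩ {c | dim c = k}) (fun c hc => And.intro (hLM ⟨hc.1.1, hc.2⟩) hc.1.2) ?_
        rw [Finsupp.mem_supported'] at hx2 hdim ⊢
        intro c hc
        by_cases h : c ∈ L
        · exact hdim c fun h' => hc ⟨h, h'⟩
        · exact hx2 c h
      · change boundary (offPart D (boundary x)) ∈ Finsupp.supported (ZMod 2) (ZMod 2) Q
        have h2 : boundary (offPart D (boundary x)) ∈ Finsupp.supported (ZMod 2) (ZMod 2) D := by
          have h3 := boundary_mem_of_isSubcomplex hD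
            (Finsupp.supported_mono Set.inter_subset_right (sub_offPart_mem (D := D) hx2))
          rw [map_sub, boundary_boundary, zero_sub] at h3
          simpa using Submodule.neg_mem _ h3
        have h4 := boundary_mem_of_isSubcomplex hM h1
        rw [Finsupp.mem_supported'] at h2 h4 ⊢
        intro c hc
        by_cases h : c ∈ D
        · exact h4 c fun h' => hc (hQ ⟨h', h⟩)
        · exact h2 c h)
    (by
      intro x _ hB
      subst hkl
      obtain ⟨_, ⟨w, hw, rfl⟩, z, hz, rfl⟩ := Submodule.mem_sup.1 hB
      rw [LinearMap.comp_apply, map_add, boundary_boundary, zero_add]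
      have hzL := chains_le hz
      -- split `z` into a part in `D` and a part `z'` in `M`
      set z' := offPart D z with hz'
      have hz'M : z' ∈ chains M (k + 1) := by
        refine offPart_mem (fun c hc => ?_) hz
        exact ⟨(hL hc.1.1).resolve_right hc.2, hc.1.2⟩
      have hzD : offPart D (boundary z) = offPart D (boundary z') := by
        have h3 := boundary_mem_of_isSubcomplex hD
          (Finsupp.supported_mono Set.inter_subset_right (sub_offPart_mem (D := D) hzL))
        have h5 := offPart_eq_zero h3
        rw [map_sub, map_sub, sub_eq_zero] at h5
        exact h5
      rw [hzD]
      have h6 : boundary z' - offPart D (boundary z') ∈ chains Q k := by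
        have h7 := boundary_mem_of_isSubcomplex hM (chains_le hz'M)
        have h8 := boundary_mem_dim hz'M
        have h9 := sub_offPart_mem (D := D) (T := M ∩ {c | dim c = k}) (y := boundary z') (by
          rw [Finsupp.mem_supported'] at h7 h8 ⊢
          intro c hc
          by_cases h : c ∈ M
          · exact h8 c fun h' => hc ⟨h, h'⟩
          · exact h7 c h)
        exact Finsupp.supported_mono (fun c hc => And.intro (hQ ⟨hc.1.1, hc.2⟩) hc.1.2) h9
      have : offPart D (boundary z') =
          boundary z' + -(boundary z' - offPart D (boundary z')) := by abel
      rw [this]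
      exact Submodule.add_mem_sup (Submodule.mem_map_of_mem hz'M) (Submodule.neg_mem _ h6))

/-! ### Complexes of plaquettes and dual complexes -/

/-- The cell complex of a collection `P` of plaquettes (two-cells): a site or a bond belongs to it if
it lies on a plaquette of `P`, a plaquette if it belongs to `P`, and a cell of dimension at least
three (such as a cube) if all its plaquettes belong to `P`. In other words, a cell belongs to it if all
its faces of dimension at most two are faces of members of `P`. -/
def complex (P : Finset (Cell d)) : Set (Cell d) :=
  {c | ∀ τ, IsFace τ c → dim τ ≤ 2 → ∃ p ∈ P, IsFace τ p}

/-- Given a set `A` of cells, the subcomplex `A^*` of the dual lattice that consists of the (closed)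
cells dual to the cells of `A`, with all their faces. -/
def dualComplex (A : Set (Cell d)) : Set (Cell d) := {τ | ∃ σ ∈ A, IsFace τ (dual σ)}

/-- The boundary `∂A^*` of `A^*`: the cells of `A^*` that are not themselves dual to a cell of `A`. -/
def dualBoundary (A : Set (Cell d)) : Set (Cell d) := dualComplex A \ dual '' A

theorem complex_isSubcomplex (P : Finset (Cell d)) : IsSubcomplex (complex P) :=
  fun _ hσ _ hτ ρ hρ h => hσ ρ (hρ.trans hτ) h

theorem complex_mono {P Q : Finset (Cell d)} (h : P ⊆ Q) : complex P ⊆ complex Q :=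
  fun _ hc τ hτ hd => (hc τ hτ hd).imp fun _ hp => ⟨h hp.1, hp.2⟩

theorem dualComplex_isSubcomplex (A : Set (Cell d)) : IsSubcomplex (dualComplex A) := by
  rintro σ ⟨ρ, hρ, h⟩ τ hτ
  exact ⟨ρ, hρ, hτ.trans h⟩

theorem dual_mem_dualComplex {A : Set (Cell d)} {c : Cell d} :
    dual c ∈ dualComplex A ↔ ∃ σ ∈ A, IsFace σ c := by
  simp only [dualComplex, Set.mem_ofPred_eq, isFace_dual]

theorem dual_mem_dualBoundary {A : Set (Cell d)} {c : Cell d} :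
    dual c ∈ dualBoundary A ↔ (∃ σ ∈ A, IsFace σ c) ∧ c ∉ A := by
  rw [dualBoundary, Set.mem_sdiff, dual_mem_dualComplex, dual_injective.mem_set_image]

theorem dualBoundary_isSubcomplex {K : Set (Cell d)} (hK : IsSubcomplex K) :
    IsSubcomplex (dualBoundary K) := by
  intro σ hσ τ hτ
  obtain ⟨σ, rfl⟩ := dual_surjective σ
  obtain ⟨τ, rfl⟩ := dual_surjective τ
  rw [dual_mem_dualBoundary] at hσ ⊢
  obtain ⟨⟨ρ, hρ, hρσ⟩, hσ⟩ := hσ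
  exact ⟨⟨ρ, hρ, hρσ.trans (isFace_dual.1 hτ)⟩, fun h => hσ (hK τ h σ (isFace_dual.1 hτ))⟩

/-! ### Frustration -/

/-- A realization of the Ising spin glass on a finite collection `Λ` of plaquettes of `ℤ^d`: the
coupling `J b` is a non-zero real number for each bond `b` of `Λ` (the values of `J` elsewhere are
never used). -/
structure Glass (d : ℕ) where
  plaquettes : Finset (Cell d)
  dim_plaquettes : ∀ p ∈ plaquettes, dim p = 2
  J : Cell d → ℝ
  J_ne_zero : ∀ b ∈ complex plaquettes, dim b = 1 → J b ≠ 0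

/-- The frustration `φ(∂p)` of a plaquette: the product of the signs of the couplings on its four
bonds. The plaquette is frustrated if `φ(∂p) = -1` and unfrustrated if `φ(∂p) = 1`. -/
def Glass.frustration (G : Glass d) (p : Cell d) : ℝ := ∏ b ∈ facets p, Real.sign (G.J b)

/-- Two cells touch each other if they have a common face. -/
def Touch (p q : Cell d) : Prop := ∃ τ, IsFace τ p ∧ IsFace τ q

/-- A frustration network `N_-`, which is a collection of frustrated plaquettes of `Λ`, together with
an unfrustration network `N_+`, which is a collection of unfrustrated plaquettes of `Λ`, such that
no other plaquette of `Λ` touches `N_- ∪ N_+`. This is so when `Λ = N_- ∪ N_+`, and when `N_-`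
consists of all the frustrated plaquettes and `N_+` of all the unfrustration networks which touch
`N_-`. -/
structure Networks (G : Glass d) where
  minus : Finset (Cell d)
  plus : Finset (Cell d)
  minus_subset : minus ⊆ G.plaquettes
  plus_subset : plus ⊆ G.plaquettes
  frustrated : ∀ p ∈ minus, G.frustration p = -1
  unfrustrated : ∀ p ∈ plus, G.frustration p = 1
  touch : ∀ p ∈ G.plaquettes, ∀ q ∈ minus ∪ plus, Touch p q → p ∈ minus ∪ plus

namespace Networks

variable {G : Glass d} (N : Networks G)

/-- The complex of the lattice `Λ`. -/
def latticeComplex (_ : Networks G) : Set (Cell d) := complex G.plaquettes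

/-- The complex of the unfrustration network `N_+`. -/
def plusComplex : Set (Cell d) := complex N.plus

/-- The complex of `N_- ∪ N_+`. -/
def unionComplex : Set (Cell d) := complex (N.minus ∪ N.plus)

/-- The cells of `N_- ∪ N_+` that do not belong to `N_+`. -/
def minusCells : Set (Cell d) := N.unionComplex \ N.plusComplex

/-- The dual `N_+^*` of the unfrustration network. -/
def plusDual : Set (Cell d) := dualComplex N.plusComplex

/-- The boundary `∂N_+^*`. -/
def plusDualBoundary : Set (Cell d) := dualBoundary N.plusComplex

/-- The boundary `∂Λ^*` of the dual of the lattice. -/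
def latticeDualBoundary : Set (Cell d) := dualBoundary N.latticeComplex

/-- The dual `N_-^*` of the frustration network. It is disjoint from `N_+`: it is formed by the cells
dual to those cells of `N_- ∪ N_+` that do not belong to `N_+`. -/
def minusDual : Set (Cell d) := dualComplex N.minusCells

/-- The part `∂N_-^* ∩ ∂Λ^*` of the boundary of `N_-^*`. -/
def minusDualBoundary : Set (Cell d) := dualBoundary N.minusCells ∩ N.latticeDualBoundary

theorem plus_subset_union : N.plusComplex ⊆ N.unionComplex := complex_mono subset_union_right

/-- If a cell of `Λ` has a face in `N_- ∪ N_+`, then it belongs to `N_- ∪ N_+`. -/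
theorem mem_unionComplex {v c : Cell d} (hv : v ∈ N.unionComplex) (hvc : IsFace v c)
    (hc : c ∈ N.latticeComplex) : c ∈ N.unionComplex := by
  -- a vertex of `v`
  let v₀ : Cell d := fun i => if Odd (v i) then v i - 1 else v i
  have hv₀ : IsFace v₀ v := by
    intro i
    by_cases h : Odd (v i) <;> simp [v₀, h]
  have hev : ∀ i, ¬ Odd (v₀ i) := by
    intro i
    by_cases h : Odd (v i)
    · simp only [v₀, h, Int.odd_iff] at h ⊢; omega
    · simp [v₀, h]
  have hv₀c := hv₀.trans hvc
  intro τ hτ hd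
  obtain ⟨p, hp, hτp⟩ := hc τ hτ hd
  -- a vertex of `τ`
  let w : Cell d := fun i => if Odd (τ i) then τ i - 1 else τ i
  have hw : IsFace w τ := by
    intro i
    by_cases h : Odd (τ i) <;> simp [w, h]
  have hew : ∀ i, ¬ Odd (w i) := by
    intro i
    by_cases h : Odd (τ i)
    · simp only [w, h, Int.odd_iff] at h ⊢; omega
    · simp [w, h]
  have hwc := hw.trans hτ
  -- walk from `v₀` to `w` along bonds of `c`
  have walk : ∀ S : Finset (Fin d), ∃ q ∈ N.minus ∪ N.plus,
      IsFace (fun i => if i ∈ S then w i else v₀ i) q := by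
    intro S
    induction S using Finset.induction_on with
    | empty =>
      have h0 : dim v₀ = 0 := by simp [dim, hev]
      simpa using hv v₀ hv₀ (by omega)
    | insert i S hi ih =>
      obtain ⟨q, hq, hvq⟩ := ih
      by_cases hwi : w i = v₀ i
      · refine ⟨q, hq, ?_⟩
        convert hvq using 2 with j
        by_cases hj : j = i
        · subst hj; simp [hi, hwi]
        · simp [hj]
      · have hci : Odd (c i) ∧ (w i = c i - 1 ∨ w i = c i + 1) ∧
            (v₀ i = c i - 1 ∨ v₀ i = c i + 1) := by
          have h1 := hwc i
          have h2 := hv₀c i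
          have h3 := hew i
          have h4 := hev i
          rw [Int.odd_iff] at *
          omega
        let u : Cell d := fun j => if j ∈ S then w j else v₀ j
        let b : Cell d := Function.update u i (c i)
        have hu : ∀ j, ¬ Odd (u j) := by
          intro j
          by_cases h : j ∈ S
          · simpa only [u, h, if_true] using hew j
          · simpa only [u, h, if_false] using hev j
        have hbd : dim b = 1 := by
          have : (univ.filter fun j => Odd (b j)) = {i} := by
            ext j
            by_cases hj : j = i
            · subst hj; simp [b, hci.1]
            · simp only [mem_filter, mem_univ, true_and, mem_singleton, hj, iff_false, b,
                Function.update_of_ne hj]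
              exact hu j
          rw [dim, this, card_singleton]
        have hbc : IsFace b c := by
          intro j
          by_cases hj : j = i
          · subst hj; simp [b]
          · simp only [b, Function.update_of_ne hj, u]
            by_cases h : j ∈ S
            · simpa only [h, if_true] using hwc j
            · simpa only [h, if_false] using hv₀c j
        obtain ⟨r, hr, hbr⟩ := hc b hbc (by omega)
        have hub : IsFace u b := by
          intro j
          by_cases hj : j = i
          · subst hj
            refine Or.inr ⟨by simpa [b] using hci.1, ?_⟩
            simpa [b, u, hi] using hci.2.2
          · exact Or.inl (by simp [b, hj])
        refine ⟨r, N.touch r hr q hq ⟨u, hub.trans hbr, hvq⟩, IsFace.trans ?_ hbr⟩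
        intro j
        by_cases hj : j = i
        · subst hj
          refine Or.inr ⟨by simpa [b] using hci.1, ?_⟩
          simpa [b] using hci.2.1
        · exact Or.inl (by simp [b, u, hj])
  obtain ⟨q, hq, hwq⟩ := walk univ
  exact ⟨p, N.touch p hp q hq ⟨w, hw.trans hτp, by simpa using hwq⟩, hτp⟩

theorem plusDualBoundary_subset :
    N.plusDualBoundary ⊆ N.minusDual ∪ N.latticeDualBoundary := by
  intro c hc
  obtain ⟨c, rfl⟩ := dual_surjective c
  obtain ⟨⟨σ, hσ, hσc⟩, hc⟩ := dual_mem_dualBoundary.1 hc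
  have hσN := N.plus_subset_union hσ
  have hσΛ : σ ∈ N.latticeComplex :=
    complex_mono (union_subset N.minus_subset N.plus_subset) hσN
  by_cases h : c ∈ N.latticeComplex
  · exact Or.inl (dual_mem_dualComplex.2
      ⟨c, ⟨N.mem_unionComplex hσN hσc h, hc⟩, IsFace.refl c⟩)
  · exact Or.inr (dual_mem_dualBoundary.2 ⟨⟨σ, hσΛ, hσc⟩, h⟩)

theorem minusDual_inter_subset :
    N.minusDual ∩ N.latticeDualBoundary ⊆ N.minusDualBoundary := by
  rintro c ⟨h1, h2⟩
  refine ⟨?_, h2⟩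
  obtain ⟨c, rfl⟩ := dual_surjective c
  refine dual_mem_dualBoundary.2 ⟨dual_mem_dualComplex.1 h1, fun h => ?_⟩
  exact (dual_mem_dualBoundary.1 h2).2
    (complex_mono (union_subset N.minus_subset N.plus_subset) h.1)

/-- The coboundary map `∂^* : H^1(N_+; ℤ/2) → H^2(N_- ∪ N_+, N_+; ℤ/2)`. -/
def coboundaryMap : Cohomology N.plusComplex ∅ 1 →ₗ[ZMod 2]
    Cohomology N.unionComplex N.plusComplex 2 :=
  SpinGlass.coboundaryMap N.plus_subset_union (complex_isSubcomplex _) 1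

/-- The boundary map `∂ : H_{d-1}(N_+^*, ∂N_+^*; ℤ/2) → H_{d-2}(N_-^*, ∂N_-^* ∩ ∂Λ^*; ℤ/2)`, which
sends the class of a hypersurface `Σ` to the class of the part of `∂Σ` outside `∂Λ^*`. -/
def boundaryMap (hd : 2 ≤ d) : Homology N.plusDual N.plusDualBoundary (d - 1) →ₗ[ZMod 2]
    Homology N.minusDual N.minusDualBoundary (d - 2) :=
  SpinGlass.boundaryMap (dualComplex_isSubcomplex _)
    (dualBoundary_isSubcomplex (complex_isSubcomplex _)) N.plusDualBoundary_subset
    N.minusDual_inter_subset (by omega)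

open Classical in
/-- The domain walls in `N_+` of a spin configuration `σ`: the chain of the `(d-1)`-cells dual to
the bonds `⟨i, j⟩` of `N_+` for which the sign of `J_{ij} σ_i σ_j` is `-1`. -/
def domainWalls (σ : Cell d → ℤˣ) : Chain d :=
  ∑ b ∈ (N.plus.biUnion facets).filter
    (fun b => Real.sign (G.J b) * ∏ i ∈ facets b, ((σ i : ℤ) : ℝ) = -1), Finsupp.single (dual b) 1

/-- The chain of the `(d-2)`-cells dual to the frustrated plaquettes of `N_-`. -/
def frustrationChain : Chain d := ∑ p ∈ N.minus, Finsupp.single (dual p) 1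

end Networks

end SpinGlass

end

namespace SpinGlass

variable {d : ℕ}

/-! ### Incidence in the dual lattice -/

/-! The duality is combinatorial: no manifold structure of the complexes enters. Passing to dual
cells reverses the face relation and exchanges dimensions `k` and `d - k`, so the value of `∂x` at
`σ^*` is the sum of `x (τ^*)` over the facets `τ` of `σ` (`boundary_dual`), which is a coboundary
formula. Let `A = K \ L` with `L`, `K` subcomplexes. Chains of `A^*` modulo chains of `∂A^*` are
functions on `A`, that is, cochains of `K` vanishing on `L`, and under this identification `∂`
becomes the coboundary of `K` (`dualCochain_boundary`). Finiteness in the relevant degrees makes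
every cochain a finite chain, and `exists_dualityEquiv` follows.

The vertical maps are the cases `L = ∅`, `K = N_+` and `L = N_+`, `K = N_- ∪ N_+`. The second needs
`∂N_-^* ⊆ ∂Λ^*` (`minusDualBoundary_eq`): a cell of `Λ` with a face in `N_- ∪ N_+` belongs to `N_- ∪
N_+`, by the touching hypothesis. The square then commutes on representatives
(`dualCochain_offPart_boundary`).

For the last claim, let `v` be the cochain of violated bonds of `N_- ∪ N_+`. In the product of
`Ĵ_{ij} σ_i σ_j` around a plaquette every spin occurs twice, so the coboundary of `v` is the
indicator of `N_-` (`coboundary_violation`). The restriction of `v` to `N_+` is dual to `Σ`, and its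
coboundary differs from that of `v` by the coboundary of a cochain vanishing on `N_+`, hence by a
relative coboundary. -/

theorem mem_facets {τ σ : Cell d} : τ ∈ facets σ ↔
    ∃ i, Odd (σ i) ∧ (τ i = σ i - 1 ∨ τ i = σ i + 1) ∧ ∀ j, j ≠ i → τ j = σ j := by
  simp only [facets, mem_biUnion, mem_filter, mem_univ, true_and, mem_insert, mem_singleton,
    Function.eq_update_iff]
  refine exists_congr fun i => and_congr_right fun _ => ?_
  tauto

/-- A dual cell extends exactly in the directions in which the cell does not, so the direction
collapsed in passing from `σ` to `τ` is the one collapsed in passing from `dual τ` to `dual σ`. -/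
theorem dual_mem_facets {τ σ : Cell d} : dual σ ∈ facets (dual τ) ↔ τ ∈ facets σ := by
  simp only [mem_facets, dual, Int.odd_iff]
  refine exists_congr fun i => ⟨fun ⟨h1, h2, h3⟩ => ⟨by omega, by omega, fun j hj => ?_⟩,
    fun ⟨h1, h2, h3⟩ => ⟨by omega, by omega, fun j hj => ?_⟩⟩
  · have := h3 j hj; omega
  · have := h3 j hj; omega

theorem dim_dual_add (c : Cell d) : dim (dual c) + dim c = d := by
  have h : (univ.filter fun i => Odd (dual c i)) = univ.filter fun i => ¬ Odd (c i) := by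
    ext i
    simp only [mem_filter, mem_univ, true_and, dual, Int.odd_iff]
    omega
  have := card_filter_add_card_filter_not (s := (univ : Finset (Fin d))) (fun i => Odd (c i))
  rw [card_univ, Fintype.card_fin] at this
  rw [dim, dim, h]
  omega

/-- Under duality the boundary operator becomes the coboundary operator. -/
theorem boundary_dual (x : Chain d) (σ : Cell d) :
    boundary x (dual σ) = ∑ τ ∈ facets σ, x (dual τ) := by
  classical
  induction x using Finsupp.induction_linear with
  | zero => simp
  | add x y hx hy => simp [hx, hy, sum_add_distrib]
  | single ρ a =>
    obtain ⟨ρ, rfl⟩ := dual_surjective ρ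
    rw [show (Finsupp.single (dual ρ) a : Chain d) = a • Finsupp.single (dual ρ) 1 by simp,
      map_smul, boundary_single, Finsupp.smul_apply, Finsupp.finsetSum_apply]
    simp only [Finsupp.smul_apply, ← smul_sum]
    congr 1
    -- Both sums collapse to an indicator of incidence between `ρ` and `σ`, one read in the dual
    -- lattice and one in the original.
    simp only [Finsupp.single_apply, dual_injective.eq_iff, sum_ite_eq', sum_ite_eq]
    exact if_congr dual_mem_facets rfl rfl

/-- A finitely supported cochain is carried to the chain of the dual cells. -/
theorem exists_chain_dual {f : Cell d → ZMod 2} (hf : f.support.Finite) :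
    ∃ x : Chain d, ∀ c, x (dual c) = f c := by
  refine ⟨(Finsupp.ofSupportFinite f hf).mapDomain dual, fun c => ?_⟩
  rw [Finsupp.mapDomain_apply dual_injective]
  rfl

/-! ### Subquotients -/

section Subquotient

variable {R M : Type*} [Ring R] [AddCommGroup M] [Module R M] {Z B : Submodule R M}

theorem Subquotient.ind {P : Subquotient Z B → Prop} (h : ∀ x (hx : x ∈ Z), P (mk x hx))
    (q : Subquotient Z B) : P q := by
  obtain ⟨⟨x, hx⟩, rfl⟩ := Submodule.mkQ_surjective (B.submoduleOf Z) q
  exact h x hx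

theorem Subquotient.mk_eq_zero {x : M} {hx : x ∈ Z} : (mk x hx : Subquotient Z B) = 0 ↔ x ∈ B :=
  Submodule.Quotient.mk_eq_zero (B.submoduleOf Z)

theorem Subquotient.mk_eq_mk {x y : M} {hx : x ∈ Z} {hy : y ∈ Z} :
    (mk x hx : Subquotient Z B) = mk y hy ↔ x - y ∈ B :=
  Submodule.Quotient.eq (B.submoduleOf Z)

theorem Subquotient.mk_congr {x y : M} {hx : x ∈ Z} (h : x = y) :
    (mk x hx : Subquotient Z B) = mk y (h ▸ hx) := by
  subst h; rfl

end Subquotient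

/-! ### Duality -/

/-- The cochain on the cells of `A` that a chain of dual cells defines. -/
noncomputable def dualCochain (A : Set (Cell d)) : Chain d →ₗ[ZMod 2] (Cell d → ZMod 2) where
  toFun x := A.indicator fun c => x (dual c)
  map_add' x y := by
    ext c
    by_cases h : c ∈ A <;> simp [h]
  map_smul' a x := by
    ext c
    by_cases h : c ∈ A <;> simp [h]

theorem dualCochain_of_mem {A : Set (Cell d)} {c : Cell d} (h : c ∈ A) (x : Chain d) :
    dualCochain A x c = x (dual c) :=
  Set.indicator_of_mem h fun c => x (dual c)

theorem dualCochain_of_notMem {A : Set (Cell d)} {c : Cell d} (h : c ∉ A) (x : Chain d) :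
    dualCochain A x c = 0 :=
  Set.indicator_of_notMem h fun c => x (dual c)

theorem mem_supported_dual {S : Set (Cell d)} {x : Chain d} :
    x ∈ Finsupp.supported (ZMod 2) (ZMod 2) S ↔ ∀ c, dual c ∉ S → x (dual c) = 0 := by
  rw [Finsupp.mem_supported']
  exact dual_surjective.forall

theorem mem_dualBoundary_or {A : Set (Cell d)} {c : Cell d} (h : dual c ∈ dualComplex A) :
    c ∈ A ∨ dual c ∈ dualBoundary A := by
  by_cases hc : c ∈ A
  · exact Or.inl hc
  · exact Or.inr (dual_mem_dualBoundary.2 ⟨dual_mem_dualComplex.1 h, hc⟩)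

theorem dual_mem_of_mem {A : Set (Cell d)} {c : Cell d} (h : c ∈ A) : dual c ∈ dualComplex A :=
  dual_mem_dualComplex.2 ⟨c, h, IsFace.refl c⟩

/-- A chain of `A^*` lies in `∂A^*` if and only if it vanishes on the cells dual to those of `A`. -/
theorem mem_supported_dualBoundary {A : Set (Cell d)} {x : Chain d}
    (hx : x ∈ Finsupp.supported (ZMod 2) (ZMod 2) (dualComplex A)) :
    x ∈ Finsupp.supported (ZMod 2) (ZMod 2) (dualBoundary A) ↔ ∀ c ∈ A, x (dual c) = 0 := by
  rw [mem_supported_dual] at hx ⊢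
  refine ⟨fun h c hc => h c fun h' => (dual_mem_dualBoundary.1 h').2 hc, fun h c hc => ?_⟩
  by_cases h' : dual c ∈ dualComplex A
  · exact h c ((mem_dualBoundary_or h').resolve_right hc)
  · exact hx c h'

section Duality

variable {K L A : Set (Cell d)} {k l : ℕ}

theorem dualCochain_mem_cochains (hA : A = K \ L) (hkl : l + k = d) {x : Chain d}
    (hx : x ∈ chains (dualComplex A) l) : dualCochain A x ∈ cochains K L k := by
  intro c hc
  by_cases h : c ∈ A
  · rw [dualCochain_of_mem h]
    refine mem_supported_dual.1 hx c fun h' => hc ?_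
    have h1 : dim (dual c) = l := h'.2
    have h2 := dim_dual_add c
    rw [hA] at h
    exact ⟨h.1, h.2, by omega⟩
  · exact dualCochain_of_notMem h x

theorem mem_chains_of_dual (hA : A = K \ L) (hkl : l + k = d) {f : Cell d → ZMod 2}
    (hf : f ∈ cochains K L k) {x : Chain d} (hx : ∀ c, x (dual c) = f c) :
    x ∈ chains (dualComplex A) l := by
  refine mem_supported_dual.2 fun c hc => ?_
  rw [hx]
  refine hf c fun h => hc ⟨dual_mem_of_mem (hA ▸ ⟨h.1, h.2.1⟩), ?_⟩
  have := dim_dual_add c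
  have := h.2.2
  omega

theorem dualCochain_eq_of_dual (hA : A = K \ L) {f : Cell d → ZMod 2}
    (hf : f ∈ cochains K L k) {x : Chain d} (hx : ∀ c, x (dual c) = f c) :
    dualCochain A x = f := by
  ext c
  by_cases h : c ∈ A
  · rw [dualCochain_of_mem h, hx]
  · rw [dualCochain_of_notMem h, hf c fun h' => h (hA ▸ ⟨h'.1, h'.2.1⟩)]

theorem finite_support_of_mem_cochains (hfin : {c | c ∈ K ∧ dim c = k}.Finite)
    {f : Cell d → ZMod 2} (hf : f ∈ cochains K L k) : f.support.Finite :=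
  hfin.subset fun c hc => by
    by_contra h
    exact hc (hf c fun h' => h ⟨h'.1, h'.2.2⟩)

/-- On relative chains, the boundary operator corresponds to the coboundary operator. -/
theorem dualCochain_boundary (hA : A = K \ L) (hK : IsSubcomplex K) (hL : IsSubcomplex L)
    {x : Chain d} (hx : x ∈ Finsupp.supported (ZMod 2) (ZMod 2) (dualComplex A)) :
    dualCochain A (boundary x) = coboundary K (dualCochain A x) := by
  ext c
  rw [coboundary_apply]
  by_cases h : c ∈ A
  · have hc : c ∈ K ∧ c ∉ L := by rw [hA] at h; exact h
    rw [dualCochain_of_mem h, Set.indicator_of_mem hc.1, boundary_dual]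
    refine sum_congr rfl fun τ hτ => ?_
    have hτc := isFace_of_mem_facets hτ
    by_cases hτA : τ ∈ A
    · rw [dualCochain_of_mem hτA]
    · rw [dualCochain_of_notMem hτA]
      -- A difference of subcomplexes is convex for the face order: a cell between `ρ ∈ A` and `c ∈
      -- A` lies in `A`. Hence a facet of `c` outside `A` has its dual outside `A^*`, where `x`
      -- vanishes.
      refine mem_supported_dual.1 hx τ fun h' => hτA ?_
      obtain ⟨ρ, hρ, hρτ⟩ := dual_mem_dualComplex.1 h'
      rw [hA] at hρ ⊢
      exact ⟨hK c hc.1 τ hτc, fun hτL => hρ.2 (hL τ hτL ρ hρτ)⟩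
  · rw [dualCochain_of_notMem h]
    by_cases hc : c ∈ K
    · rw [Set.indicator_of_mem hc]
      have hcL : c ∈ L := by
        by_contra hcL
        exact h (hA ▸ ⟨hc, hcL⟩)
      -- All facets of a cell of `L` lie in `L`, so the restricted cochain vanishes on them.
      refine (sum_eq_zero fun τ hτ => dualCochain_of_notMem (fun h' => ?_) x).symm
      rw [hA] at h'
      exact h'.2 (hL c hcL τ (isFace_of_mem_facets hτ))
    · rw [Set.indicator_of_notMem hc]

/-- The kernel of restriction to `A`: this is what identifies relative chains of `(A^*, ∂A^*)` with
functions on `A`. -/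
theorem dualCochain_eq_zero_iff {x : Chain d}
    (hx : x ∈ Finsupp.supported (ZMod 2) (ZMod 2) (dualComplex A)) :
    dualCochain A x = 0 ↔ x ∈ Finsupp.supported (ZMod 2) (ZMod 2) (dualBoundary A) := by
  rw [mem_supported_dualBoundary hx]
  refine ⟨fun h c hc => by rw [← dualCochain_of_mem hc, h]; rfl, fun h => ?_⟩
  ext c
  by_cases hc : c ∈ A
  · rw [dualCochain_of_mem hc, h c hc]; rfl
  · rw [dualCochain_of_notMem hc]; rfl

theorem mem_chains_dualBoundary_iff {x : Chain d} (hx : x ∈ chains (dualComplex A) l) :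
    x ∈ chains (dualBoundary A) l ↔ dualCochain A x = 0 := by
  rw [dualCochain_eq_zero_iff (chains_le hx)]
  refine ⟨fun h => chains_le h, fun h => ?_⟩
  rw [chains, Finsupp.mem_supported'] at hx ⊢
  rw [Finsupp.mem_supported'] at h
  intro c hc
  by_cases hcd : dim c = l
  · exact h c fun h' => hc ⟨h', hcd⟩
  · exact hx c fun h' => hcd h'.2

/-- The boundary of `x` lies in `∂A^*` exactly when its restriction to `A` vanishes, and that
restriction is the coboundary of the restriction of `x`. -/
theorem mem_cycles_iff (hA : A = K \ L) (hK : IsSubcomplex K) (hL : IsSubcomplex L)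
    (hkl : l + k = d) {x : Chain d} (hx : x ∈ chains (dualComplex A) l) :
    x ∈ cycles (dualComplex A) (dualBoundary A) l ↔ dualCochain A x ∈ cocycles K L k := by
  have h := dualCochain_eq_zero_iff
    (boundary_mem_of_isSubcomplex (dualComplex_isSubcomplex A) (chains_le hx))
  rw [dualCochain_boundary hA hK hL (chains_le hx)] at h
  exact ⟨fun hc => ⟨dualCochain_mem_cochains hA hkl hx, h.2 hc.2⟩, fun hc => ⟨hx, h.1 hc.2⟩⟩

theorem boundary_mem_chains {M : Set (Cell d)} (hM : IsSubcomplex M) {x : Chain d}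
    (hx : x ∈ chains M (l + 1)) : boundary x ∈ chains M l := by
  refine boundary_mem_supported (S := {c | c ∈ M ∧ dim c = l + 1}) (fun σ hσ τ hτ => ?_) hx
  have := dim_of_mem_facets hτ
  exact ⟨hM σ hσ.1 τ (isFace_of_mem_facets hτ), by have := hσ.2; omega⟩

/-- Restriction kills the chains of `∂A^*`, which settles one direction. Conversely a cochain with
the given coboundary lifts to a chain `w`, finite by `hfin`, and `x - ∂w` restricts to zero on `A`.
The degree is `k + 1` because `coboundaries` is defined by cases on the degree. -/
theorem mem_boundaries_iff (hA : A = K \ L) (hK : IsSubcomplex K) (hL : IsSubcomplex L)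
    (hkl : l + (k + 1) = d) (hfin : {c | c ∈ K ∧ dim c = k}.Finite) {x : Chain d}
    (hx : x ∈ chains (dualComplex A) l) :
    x ∈ boundaries (dualComplex A) (dualBoundary A) l ↔
      dualCochain A x ∈ coboundaries K L (k + 1) := by
  constructor
  · intro h
    obtain ⟨_, ⟨w, hw, rfl⟩, z, hz, rfl⟩ := Submodule.mem_sup.1 h
    have hz0 : dualCochain A z = 0 := by
      refine (mem_chains_dualBoundary_iff (l := l) ?_).1 hz
      exact Finsupp.supported_mono (fun c hc => And.intro hc.1.1 hc.2) hz
    rw [map_add, hz0, add_zero, dualCochain_boundary hA hK hL (chains_le hw)]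
    exact Submodule.mem_map_of_mem (dualCochain_mem_cochains hA (by omega) hw)
  · rintro ⟨g, hg, hgx⟩
    obtain ⟨w, hw⟩ := exists_chain_dual (finite_support_of_mem_cochains hfin hg)
    have hwc := mem_chains_of_dual (l := l + 1) hA (by omega) hg hw
    have hbc := boundary_mem_chains (dualComplex_isSubcomplex A) hwc
    rw [← add_sub_cancel (boundary w) x]
    refine Submodule.add_mem_sup (Submodule.mem_map_of_mem hwc)
      ((mem_chains_dualBoundary_iff (Submodule.sub_mem _ hx hbc)).2 ?_)
    rw [map_sub, dualCochain_boundary hA hK hL (chains_le hwc), dualCochain_eq_of_dual hA hg hw,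
      hgx, sub_self]

/-- Sending a relative cycle of the dual complex to the cochain of the dual cells induces an
isomorphism of homology and cohomology. -/
theorem exists_dualityEquiv (hA : A = K \ L) (hK : IsSubcomplex K) (hL : IsSubcomplex L)
    (hkl : l + (k + 1) = d) (hfin : ∀ j ≤ k + 1, {c | c ∈ K ∧ dim c = j}.Finite) :
    ∃ e : Homology (dualComplex A) (dualBoundary A) l ≃ₗ[ZMod 2] Cohomology K L (k + 1),
      ∀ x (hx : x ∈ cycles (dualComplex A) (dualBoundary A) l)
        (h : dualCochain A x ∈ cocycles K L (k + 1)),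
        e (Subquotient.mk x hx) = Subquotient.mk (dualCochain A x) h := by
  have hfk := hfin k (by omega)
  -- The map starts from homology because `dualCochain` is defined on all chains, while a cochain
  -- lifts to a chain only if its support is finite.
  let e : Homology (dualComplex A) (dualBoundary A) l →ₗ[ZMod 2] Cohomology K L (k + 1) :=
    Subquotient.map (dualCochain A)
      (fun x hx => (mem_cycles_iff hA hK hL hkl hx.1).1 hx)
      (fun x hx hB => (mem_boundaries_iff hA hK hL hkl hfk hx.1).1 hB)
  have hinj : Function.Injective e := by
    refine (injective_iff_map_eq_zero e).2 fun q => ?_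
    induction q using Subquotient.ind with
    | h x hx =>
      intro h
      exact Subquotient.mk_eq_zero.2
        ((mem_boundaries_iff hA hK hL hkl hfk hx.1).2 (Subquotient.mk_eq_zero.1 h))
  have hsurj : Function.Surjective e := by
    intro q
    induction q using Subquotient.ind with
    | h f hf =>
      obtain ⟨x, hx⟩ :=
        exists_chain_dual (finite_support_of_mem_cochains (hfin (k + 1) le_rfl) hf.1)
      have hxc := mem_chains_of_dual hA hkl hf.1 hx
      have hxf := dualCochain_eq_of_dual hA hf.1 hx
      refine ⟨Subquotient.mk x ((mem_cycles_iff hA hK hL hkl hxc).2 (by rwa [hxf])), ?_⟩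
      exact Subquotient.mk_congr hxf
  exact ⟨LinearEquiv.ofBijective e ⟨hinj, hsurj⟩, fun _ _ _ => rfl⟩

/-- Every relative cocycle is the cochain of the cells dual to a relative cycle. -/
theorem exists_dual_cycle (hA : A = K \ L) (hK : IsSubcomplex K) (hL : IsSubcomplex L)
    (hkl : l + k = d) (hfin : {c | c ∈ K ∧ dim c = k}.Finite) {f : Cell d → ZMod 2}
    (hf : f ∈ cocycles K L k) :
    ∃ x ∈ cycles (dualComplex A) (dualBoundary A) l,
      (∀ c, x (dual c) = f c) ∧ dualCochain A x = f := by
  obtain ⟨x, hx⟩ := exists_chain_dual (finite_support_of_mem_cochains hfin hf.1)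
  have hxf := dualCochain_eq_of_dual hA hf.1 hx
  exact ⟨x, (mem_cycles_iff hA hK hL hkl (mem_chains_of_dual hA hkl hf.1 hx)).2 (by rwa [hxf]),
    hx, hxf⟩

end Duality

/-! ### Complexes of plaquettes -/

theorem finite_faces (p : Cell d) : {c : Cell d | IsFace c p}.Finite := by
  refine (Set.Finite.pi' (t := fun i => Set.Icc (p i - 1) (p i + 1))
    fun i => Set.finite_Icc _ _).subset fun c hc i => ?_
  have := hc i
  rw [Set.mem_Icc]
  omega

/-- In dimension at most two the condition defining `complex` applies to the cell itself, which is
therefore a face of one of finitely many plaquettes. -/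
theorem finite_complex (P : Finset (Cell d)) {k : ℕ} (hk : k ≤ 2) :
    {c | c ∈ complex P ∧ dim c = k}.Finite := by
  refine (P.finite_toSet.biUnion fun p _ => finite_faces p).subset fun c hc => ?_
  obtain ⟨p, hp, hcp⟩ := hc.1 c (IsFace.refl c) (by have := hc.2; omega)
  exact Set.mem_biUnion hp hcp

theorem mem_complex_of_isFace {P : Finset (Cell d)} {p c : Cell d} (hp : p ∈ P) (h : IsFace c p) :
    c ∈ complex P := fun _ hτ _ => ⟨p, hp, hτ.trans h⟩

/-- A face has no new odd coordinates, so equal dimension forces equal parities, and a coordinate in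
which the two cells differ would change parity. -/
theorem IsFace.eq_of_dim_eq {τ σ : Cell d} (h : IsFace τ σ) (hd : dim τ = dim σ) : τ = σ := by
  have hsub : (univ.filter fun i => Odd (τ i)) ⊆ univ.filter fun i => Odd (σ i) := by
    intro i
    have := h i
    simp only [mem_filter, mem_univ, true_and, Int.odd_iff] at this ⊢
    omega
  have heq := eq_of_subset_of_card_le hsub hd.ge
  ext i
  have h1 : Odd (τ i) ↔ Odd (σ i) := by simpa using congrArg (i ∈ ·) heq
  have h2 := h i
  rw [Int.odd_iff, Int.odd_iff] at h1
  rw [Int.odd_iff] at h2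
  omega

theorem mem_of_mem_complex {P : Finset (Cell d)} (hP : ∀ p ∈ P, dim p = 2) {c : Cell d}
    (hc : c ∈ complex P) (hd : dim c = 2) : c ∈ P := by
  obtain ⟨p, hp, h⟩ := hc c (IsFace.refl c) hd.le
  rwa [h.eq_of_dim_eq (hd.trans (hP p hp).symm)]

/-- Exactly one odd coordinate becomes even, and all the others must be unchanged. -/
theorem exists_facet_of_isFace {τ σ : Cell d} (h : IsFace τ σ) (hd : dim τ + 1 = dim σ) :
    τ ∈ facets σ := by
  have hsub : (univ.filter fun i => Odd (τ i)) ⊆ univ.filter fun i => Odd (σ i) := by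
    intro i
    have := h i
    simp only [mem_filter, mem_univ, true_and, Int.odd_iff] at this ⊢
    omega
  have hcard := card_sdiff_add_card_eq_card hsub
  have h1 : ((univ.filter fun i => Odd (σ i)) \ univ.filter fun i => Odd (τ i)).card = 1 := by
    rw [dim, dim] at hd; omega
  obtain ⟨i, hi⟩ := card_eq_one.1 h1
  have hmem : ∀ j, (Odd (σ j) ∧ ¬ Odd (τ j)) ↔ j = i := fun j => by
    simpa using congrArg (j ∈ ·) hi
  have hii := (hmem i).2 rfl
  refine mem_facets.2 ⟨i, hii.1, ?_, fun j hj => ?_⟩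
  · exact ((h i).resolve_left fun h' => hii.2 (h' ▸ hii.1)).2
  · refine (h j).resolve_right fun h' => hj ((hmem j).1 ⟨h'.1, ?_⟩)
    have := h'.2
    have := h'.1
    rw [Int.odd_iff] at *
    omega

/-! ### Signs -/

/-- The parity of a sign. -/
def parity : ℤˣ →* Multiplicative (ZMod 2) where
  toFun u := Multiplicative.ofAdd (if u = -1 then 1 else 0)
  map_one' := by decide
  map_mul' := by decide

theorem sum_parity {ι : Type*} (s : Finset ι) (v : ι → ℤˣ) :
    ∑ i ∈ s, (if v i = -1 then 1 else 0 : ZMod 2) = if ∏ i ∈ s, v i = -1 then 1 else 0 :=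
  (congrArg Multiplicative.toAdd (map_prod parity v s)).symm

/-- This is `∂∂ = 0` with values in the group of signs, written additively as a module over `ℤ/2`.
-/
theorem prod_facets_facets (σ : Cell d) (s : Cell d → ℤˣ) :
    ∏ τ ∈ facets σ, ∏ ρ ∈ facets τ, s ρ = 1 :=
  sum_facets_facets (M := Additive ℤˣ) σ fun c => Additive.ofMul (s c)

theorem exists_units_eq_sign {r : ℝ} (hr : r ≠ 0) : ∃ u : ℤˣ, ((u : ℤ) : ℝ) = Real.sign r := by
  rcases hr.lt_or_gt with h | h
  · exact ⟨-1, by simp [Real.sign_of_neg h]⟩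
  · exact ⟨1, by simp [Real.sign_of_pos h]⟩

theorem Glass.frustration_eq_units {G : Glass d} {u : Cell d → ℤˣ} {p : Cell d}
    (hu : ∀ b ∈ facets p, ((u b : ℤ) : ℝ) = Real.sign (G.J b)) :
    G.frustration p = ((∏ b ∈ facets p, u b : ℤˣ) : ℤ) := by
  rw [Glass.frustration, Units.coe_prod, Int.cast_prod]
  exact prod_congr rfl fun b hb => (hu b hb).symm

theorem units_cast_eq_neg_one {u : ℤˣ} : ((u : ℤ) : ℝ) = -1 ↔ u = -1 := by
  rcases Int.units_eq_one_or u with rfl | rfl <;> norm_num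

open Classical in
/-- The number of bonds of a plaquette at which a spin configuration violates the coupling is even
or odd according as the plaquette is unfrustrated or frustrated. -/
theorem sum_violated {G : Glass d} (s : Cell d → ℤˣ) {p : Cell d} (hp : p ∈ G.plaquettes) :
    ∑ b ∈ facets p, (if Real.sign (G.J b) * ∏ i ∈ facets b, ((s i : ℤ) : ℝ) = -1
      then 1 else 0 : ZMod 2) = if G.frustration p = -1 then 1 else 0 := by
  have hJ : ∀ b, ∃ u : ℤˣ, b ∈ facets p → ((u : ℤ) : ℝ) = Real.sign (G.J b) := by
    intro b
    by_cases hb : b ∈ facets p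
    · obtain ⟨u, hu⟩ := exists_units_eq_sign (G.J_ne_zero b
        (mem_complex_of_isFace hp (isFace_of_mem_facets hb))
        (by have := dim_of_mem_facets hb; have := G.dim_plaquettes p hp; omega))
      exact ⟨u, fun _ => hu⟩
    · exact ⟨1, fun h => absurd h hb⟩
  choose u hu using hJ
  have h1 : ∀ b ∈ facets p, (Real.sign (G.J b) * ∏ i ∈ facets b, ((s i : ℤ) : ℝ) = -1 ↔
      u b * ∏ i ∈ facets b, s i = -1) := by
    intro b hb
    rw [← units_cast_eq_neg_one, ← hu b hb, Units.val_mul, Units.coe_prod]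
    push_cast
    rfl
  rw [sum_congr rfl fun b hb => if_congr (h1 b hb) rfl rfl]
  refine (sum_parity (facets p) fun b => u b * ∏ i ∈ facets b, s i).trans ?_
  -- The spins cancel, and only the couplings remain.
  rw [prod_mul_distrib, prod_facets_facets, mul_one]
  refine if_congr ?_ rfl rfl
  rw [Glass.frustration_eq_units hu, units_cast_eq_neg_one]

/-! ### Networks -/

namespace Networks

variable {G : Glass d} (N : Networks G)

theorem union_subset_lattice : N.unionComplex ⊆ N.latticeComplex :=
  complex_mono (union_subset N.minus_subset N.plus_subset)

/-- The boundary of `N_-^*` lies in the boundary of the lattice. -/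
theorem minusDualBoundary_eq : N.minusDualBoundary = dualBoundary N.minusCells := by
  refine Set.inter_eq_left.2 fun c hc => ?_
  obtain ⟨c, rfl⟩ := dual_surjective c
  obtain ⟨⟨σ, hσ, hσc⟩, hc⟩ := dual_mem_dualBoundary.1 hc
  refine dual_mem_dualBoundary.2 ⟨⟨σ, N.union_subset_lattice hσ.1, hσc⟩, fun h => hc ?_⟩
  -- The touching hypothesis enters here: if `c` were in `Λ`, it would be in `N_- ∪ N_+`, and not in
  -- `N_+` because its face `σ` is not.
  exact ⟨N.mem_unionComplex hσ.1 hσc h,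
    fun h' => hσ.2 (complex_isSubcomplex _ c h' σ hσc)⟩

theorem notMem_latticeDualBoundary {c : Cell d} (hc : c ∈ N.latticeComplex) :
    dual c ∉ N.latticeDualBoundary := fun h => (dual_mem_dualBoundary.1 h).2 hc

/-- The existential exposes the cycle condition already proved inside `boundaryMap`. -/
theorem boundaryMap_mk (hd : 2 ≤ d) {x : Chain d}
    (hx : x ∈ cycles N.plusDual N.plusDualBoundary (d - 1)) :
    ∃ h, N.boundaryMap hd (Subquotient.mk x hx) =
      Subquotient.mk (offPart N.latticeDualBoundary (boundary x)) h := ⟨_, rfl⟩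

/-- The part outside `∂Λ^*` of the boundary of a relative cycle of `N_+^*` is carried by the cells
dual to those of `N_-`. -/
theorem offPart_boundary_apply {k : ℕ} {x : Chain d} (hx : x ∈ cycles N.plusDual N.plusDualBoundary k)
    (c : Cell d) : offPart N.latticeDualBoundary (boundary x) (dual c) =
      N.minusCells.indicator (fun c => ∑ b ∈ facets c, x (dual b)) c := by
  by_cases hc : c ∈ N.minusCells
  · rw [Set.indicator_of_mem hc, offPart_apply_of_notMem
      (N.notMem_latticeDualBoundary (N.union_subset_lattice hc.1)), boundary_dual]
  · rw [Set.indicator_of_notMem hc]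
    by_cases hcD : dual c ∈ N.latticeDualBoundary
    · exact offPart_apply_of_mem hcD _
    · rw [offPart_apply_of_notMem hcD]
      -- The support of `∂x` lies in `∂N_+^*`, which is covered by `N_-^*` and `∂Λ^*`. The cells of
      -- `N_-^*` not dual to `minusCells` form `∂N_-^*`, which is again in `∂Λ^*`.
      refine mem_supported_dual.1 hx.2 c fun h => ?_
      rcases N.plusDualBoundary_subset h with h | h
      · rcases mem_dualBoundary_or h with h | h
        · exact hc h
        · rw [← minusDualBoundary_eq] at h
          exact hcD h.2
      · exact hcD h

theorem dim_of_mem_union {p : Cell d} (hp : p ∈ N.minus ∪ N.plus) : dim p = 2 :=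
  G.dim_plaquettes p (union_subset N.minus_subset N.plus_subset hp)

theorem minus_subset_minusCells {p : Cell d} (hp : p ∈ N.minus) : p ∈ N.minusCells := by
  refine ⟨mem_complex_of_isFace (mem_union_left _ hp) (IsFace.refl p), fun h => ?_⟩
  have h1 := N.unfrustrated p (mem_of_mem_complex
    (fun q hq => N.dim_of_mem_union (mem_union_right _ hq)) h
    (N.dim_of_mem_union (mem_union_left _ hp)))
  rw [N.frustrated p hp] at h1
  norm_num at h1

theorem mem_biUnion_facets {b : Cell d} :
    b ∈ N.plus.biUnion facets ↔ b ∈ N.plusComplex ∧ dim b = 1 := by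
  rw [mem_biUnion]
  constructor
  · rintro ⟨p, hp, hb⟩
    have := dim_of_mem_facets hb
    have := N.dim_of_mem_union (mem_union_right _ hp)
    exact ⟨mem_complex_of_isFace hp (isFace_of_mem_facets hb), by omega⟩
  · rintro ⟨hb, h1⟩
    obtain ⟨p, hp, h⟩ := hb b (IsFace.refl b) (by omega)
    have := N.dim_of_mem_union (mem_union_right _ hp)
    exact ⟨p, hp, exists_facet_of_isFace h (by omega)⟩

open Classical in
theorem sum_single_dual_apply (s : Finset (Cell d)) (c : Cell d) :
    (∑ b ∈ s, Finsupp.single (dual b) 1 : Chain d) (dual c) = if c ∈ s then 1 else 0 := by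
  rw [Finsupp.finsetSum_apply]
  simp only [Finsupp.single_apply, dual_injective.eq_iff, sum_ite_eq']

/-! ### The vertical isomorphisms and the commutative square -/

theorem plusComplex_isSubcomplex : IsSubcomplex N.plusComplex := complex_isSubcomplex _

theorem unionComplex_isSubcomplex : IsSubcomplex N.unionComplex := complex_isSubcomplex _

theorem exists_plusEquiv (hd : 2 ≤ d) :
    ∃ e : Homology N.plusDual N.plusDualBoundary (d - 1) ≃ₗ[ZMod 2] Cohomology N.plusComplex ∅ 1,
      ∀ x (hx : x ∈ cycles N.plusDual N.plusDualBoundary (d - 1))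
        (h : dualCochain N.plusComplex x ∈ cocycles N.plusComplex ∅ 1),
        e (Subquotient.mk x hx) = Subquotient.mk (dualCochain N.plusComplex x) h :=
  exists_dualityEquiv Set.sdiff_empty.symm N.plusComplex_isSubcomplex (fun _ h => h.elim)
    (by omega) fun _ hj => finite_complex _ (by omega)

/-- The general duality is relative to all of `∂N_-^*`; `minusDualBoundary_eq` shows that
intersecting with `∂Λ^*` removes nothing. -/
theorem exists_minusEquiv (hd : 2 ≤ d) :
    ∃ e : Homology N.minusDual N.minusDualBoundary (d - 2) ≃ₗ[ZMod 2]
        Cohomology N.unionComplex N.plusComplex 2,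
      ∀ x (hx : x ∈ cycles N.minusDual N.minusDualBoundary (d - 2))
        (h : dualCochain N.minusCells x ∈ cocycles N.unionComplex N.plusComplex 2),
        e (Subquotient.mk x hx) = Subquotient.mk (dualCochain N.minusCells x) h := by
  rw [minusDualBoundary_eq]
  exact exists_dualityEquiv rfl N.unionComplex_isSubcomplex N.plusComplex_isSubcomplex
    (by omega) fun _ hj => finite_complex _ (by omega)

theorem exists_plus_cycle (hd : 2 ≤ d) {α : Cell d → ZMod 2} (hα : α ∈ cocycles N.plusComplex ∅ 1) :
    ∃ x ∈ cycles N.plusDual N.plusDualBoundary (d - 1),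
      (∀ c, x (dual c) = α c) ∧ dualCochain N.plusComplex x = α :=
  exists_dual_cycle Set.sdiff_empty.symm N.plusComplex_isSubcomplex (fun _ h => h.elim)
    (by omega) (finite_complex _ (by omega)) hα

theorem exists_minus_cycle (hd : 2 ≤ d) {η : Cell d → ZMod 2}
    (hη : η ∈ cocycles N.unionComplex N.plusComplex 2) :
    ∃ x ∈ cycles N.minusDual N.minusDualBoundary (d - 2),
      (∀ c, x (dual c) = η c) ∧ dualCochain N.minusCells x = η := by
  rw [minusDualBoundary_eq]
  exact exists_dual_cycle rfl N.unionComplex_isSubcomplex N.plusComplex_isSubcomplex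
    (by omega) (finite_complex _ (by omega)) hη

/-- Commutativity on representatives: since `x` is dual to `α` on all cells, hence to its extension
by zero, the two sides agree on `minusCells`. Elsewhere both vanish, the right side because `α` is
closed on `N_+`. -/
theorem dualCochain_offPart_boundary {k : ℕ} {x : Chain d}
    (hx : x ∈ cycles N.plusDual N.plusDualBoundary k) {α : Cell d → ZMod 2}
    (hα : α ∈ cocycles N.plusComplex ∅ 1) (h : ∀ c, x (dual c) = α c) :
    dualCochain N.minusCells (offPart N.latticeDualBoundary (boundary x)) =
      coboundary N.unionComplex α := by
  ext c
  by_cases hc : c ∈ N.minusCells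
  · rw [dualCochain_of_mem hc, N.offPart_boundary_apply hx, Set.indicator_of_mem hc,
      coboundary_apply, Set.indicator_of_mem hc.1]
    exact sum_congr rfl fun b _ => h b
  · rw [dualCochain_of_notMem hc]
    exact ((coboundary_mem_cocycles N.plus_subset_union N.unionComplex_isSubcomplex hα).1 c
      fun h' => hc ⟨h'.1, h'.2.1⟩).symm

theorem boundaryMap_comm (hd : 2 ≤ d)
    {e₁ : Homology N.plusDual N.plusDualBoundary (d - 1) ≃ₗ[ZMod 2] Cohomology N.plusComplex ∅ 1}
    (he₁ : ∀ x (hx : x ∈ cycles N.plusDual N.plusDualBoundary (d - 1))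
      (h : dualCochain N.plusComplex x ∈ cocycles N.plusComplex ∅ 1),
      e₁ (Subquotient.mk x hx) = Subquotient.mk (dualCochain N.plusComplex x) h)
    {e₂ : Homology N.minusDual N.minusDualBoundary (d - 2) ≃ₗ[ZMod 2]
        Cohomology N.unionComplex N.plusComplex 2}
    (he₂ : ∀ x (hx : x ∈ cycles N.minusDual N.minusDualBoundary (d - 2))
      (h : dualCochain N.minusCells x ∈ cocycles N.unionComplex N.plusComplex 2),
      e₂ (Subquotient.mk x hx) = Subquotient.mk (dualCochain N.minusCells x) h)
    (q : Cohomology N.plusComplex ∅ 1) :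
    N.coboundaryMap q = e₂ (N.boundaryMap hd (e₁.symm q)) := by
  induction q using Subquotient.ind with
  | h α hα =>
    obtain ⟨x, hx, hxα, hdx⟩ := N.exists_plus_cycle hd hα
    have h1 : e₁.symm (Subquotient.mk α hα) = Subquotient.mk x hx := by
      rw [LinearEquiv.symm_apply_eq, he₁ x hx (by rwa [hdx])]
      exact Subquotient.mk_congr hdx.symm
    obtain ⟨hb, h2⟩ := N.boundaryMap_mk hd hx
    have h3 := N.dualCochain_offPart_boundary hx hα hxα
    have h4 := coboundary_mem_cocycles N.plus_subset_union N.unionComplex_isSubcomplex hα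
    rw [h1, h2, he₂ _ hb (by rwa [h3])]
    exact Subquotient.mk_congr h3.symm

/-! ### Violated bonds, domain walls and frustrated plaquettes -/

open Classical in
/-- The cochain of the bonds of `N_- ∪ N_+` at which a spin configuration violates the coupling. -/
noncomputable def violation (s : Cell d → ℤˣ) (b : Cell d) : ZMod 2 :=
  if (b ∈ N.unionComplex ∧ dim b = 1) ∧
    Real.sign (G.J b) * ∏ i ∈ facets b, ((s i : ℤ) : ℝ) = -1 then 1 else 0

theorem violation_of_dim_ne {s : Cell d → ℤˣ} {b : Cell d} (h : dim b ≠ 1) :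
    N.violation s b = 0 := if_neg fun h' => h h'.1.2

theorem violation_of_notMem {s : Cell d → ℤˣ} {b : Cell d} (h : b ∉ N.unionComplex) :
    N.violation s b = 0 := if_neg fun h' => h h'.1.1

-- The coboundary counts violated bonds of a plaquette mod 2, so it detects frustration by
-- `sum_violated`; the frustrated plaquettes of `N_- ∪ N_+` are those of `N_-`.
open Classical in
theorem coboundary_violation (s : Cell d → ℤˣ) :
    coboundary N.unionComplex (N.violation s) = fun c => if c ∈ N.minus then 1 else 0 := by
  ext c
  by_cases h : c ∈ N.unionComplex ∧ dim c = 2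
  · have hc := mem_of_mem_complex (fun q hq => N.dim_of_mem_union hq) h.1 h.2
    have hcG := union_subset N.minus_subset N.plus_subset hc
    rw [coboundary_apply, Set.indicator_of_mem h.1]
    refine Eq.trans (sum_congr rfl fun b hb => ?_) ((sum_violated s hcG).trans ?_)
    · refine if_congr (and_iff_right ⟨N.unionComplex_isSubcomplex c h.1 b
        (isFace_of_mem_facets hb), ?_⟩) rfl rfl
      have := dim_of_mem_facets hb
      omega
    · refine if_congr ⟨fun h' => ?_, N.frustrated c⟩ rfl rfl
      refine (mem_union.1 hc).resolve_right fun h'' => ?_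
      rw [N.unfrustrated c h''] at h'
      norm_num at h'
  · rw [coboundary_degree (fun c hc => N.violation_of_dim_ne hc) h]
    refine (if_neg fun h' => h ?_).symm
    exact ⟨(N.minus_subset_minusCells h').1, N.dim_of_mem_union (mem_union_left _ h')⟩

open Classical in
theorem indicator_violation_mem_cocycles (s : Cell d → ℤˣ) :
    N.plusComplex.indicator (N.violation s) ∈ cocycles N.plusComplex ∅ 1 := by
  refine ⟨fun c hc => ?_, ?_⟩
  · by_cases h : c ∈ N.plusComplex
    · rw [Set.indicator_of_mem h]
      exact N.violation_of_dim_ne fun h' => hc ⟨h, fun h => h, h'⟩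
    · exact Set.indicator_of_notMem h _
  · refine LinearMap.mem_ker.2 (funext fun c => ?_)
    rw [coboundary_apply]
    by_cases h : c ∈ N.plusComplex
    · have h1 := congrFun (N.coboundary_violation s) c
      rw [coboundary_apply, Set.indicator_of_mem (N.plus_subset_union h)] at h1
      rw [Set.indicator_of_mem h, sum_congr rfl fun b hb => Set.indicator_of_mem
        (N.plusComplex_isSubcomplex c h b (isFace_of_mem_facets hb)) _]
      exact h1.trans (if_neg fun h' => (N.minus_subset_minusCells h').2 h)
    · exact Set.indicator_of_notMem h _

theorem domainWalls_apply (s : Cell d → ℤˣ) (c : Cell d) :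
    N.domainWalls s (dual c) = N.plusComplex.indicator (N.violation s) c := by
  classical
  rw [domainWalls, sum_single_dual_apply]
  by_cases h : c ∈ N.plusComplex
  · rw [Set.indicator_of_mem h, violation]
    refine if_congr ?_ rfl rfl
    rw [mem_filter, mem_biUnion_facets]
    simp only [h, N.plus_subset_union h]
  · rw [Set.indicator_of_notMem h]
    exact if_neg fun h' => h (N.mem_biUnion_facets.1 (mem_filter.1 h').1).1

theorem domainWalls_mem_cycles (hd : 2 ≤ d) (s : Cell d → ℤˣ) :
    N.domainWalls s ∈ cycles N.plusDual N.plusDualBoundary (d - 1) := by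
  obtain ⟨x, hx, hxα, -⟩ := N.exists_plus_cycle hd (N.indicator_violation_mem_cocycles s)
  convert hx
  ext c
  obtain ⟨c, rfl⟩ := dual_surjective c
  rw [hxα, domainWalls_apply]

theorem frustrationChain_apply (s : Cell d → ℤˣ) (c : Cell d) :
    N.frustrationChain (dual c) = coboundary N.unionComplex (N.violation s) c := by
  classical
  rw [frustrationChain, sum_single_dual_apply, coboundary_violation]

/-- It vanishes on `N_+` because the plaquettes there are unfrustrated. It need not be a relative
coboundary, since the violation cochain itself may be non-zero on `N_+`. -/
theorem coboundary_violation_mem_cocycles (s : Cell d → ℤˣ) :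
    coboundary N.unionComplex (N.violation s) ∈ cocycles N.unionComplex N.plusComplex 2 := by
  classical
  refine ⟨fun c hc => ?_, coboundary_coboundary N.unionComplex_isSubcomplex _⟩
  rw [coboundary_violation]
  refine if_neg fun h => hc ?_
  have := N.minus_subset_minusCells h
  exact ⟨this.1, this.2, N.dim_of_mem_union (mem_union_left _ h)⟩

theorem frustrationChain_mem_cycles (hd : 2 ≤ d) :
    N.frustrationChain ∈ cycles N.minusDual N.minusDualBoundary (d - 2) := by
  -- The chain does not depend on the spins, so the constant configuration `1` serves as well as any
  -- other.
  obtain ⟨x, hx, hxα, -⟩ := N.exists_minus_cycle hd (N.coboundary_violation_mem_cocycles 1)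
  convert hx
  ext c
  obtain ⟨c, rfl⟩ := dual_surjective c
  rw [hxα, frustrationChain_apply]

/-- Vanishing on `N_+` is the point: the coboundary of this cochain is a relative coboundary and
accounts for the difference between `∂Σ` and `Γ`. -/
theorem indicator_minusCells_violation_mem_cochains (s : Cell d → ℤˣ) :
    N.minusCells.indicator (N.violation s) ∈ cochains N.unionComplex N.plusComplex 1 := by
  intro c hc
  by_cases h : c ∈ N.minusCells
  · rw [Set.indicator_of_mem h]
    exact N.violation_of_dim_ne fun h' => hc ⟨h.1, h.2, h'⟩
  · exact Set.indicator_of_notMem h _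

/-- The violated bonds of `N_- ∪ N_+` are those of `N_+` together with those of `N_-`. -/
theorem violation_eq_add (s : Cell d → ℤˣ) : N.violation s =
    N.plusComplex.indicator (N.violation s) + N.minusCells.indicator (N.violation s) := by
  ext c
  rw [Pi.add_apply]
  by_cases h : c ∈ N.plusComplex
  · rw [Set.indicator_of_mem h, Set.indicator_of_notMem fun h' : c ∈ N.minusCells => h'.2 h,
      add_zero]
  · rw [Set.indicator_of_notMem h, zero_add]
    by_cases hc : c ∈ N.unionComplex
    · exact (Set.indicator_of_mem (s := N.minusCells) ⟨hc, h⟩ _).symm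
    · rw [Set.indicator_of_notMem fun h' : c ∈ N.minusCells => hc h'.1, N.violation_of_notMem hc]

theorem offPart_boundary_sub_frustrationChain_mem (hd : 2 ≤ d) (s : Cell d → ℤˣ)
    (h : offPart N.latticeDualBoundary (boundary (N.domainWalls s)) ∈
      cycles N.minusDual N.minusDualBoundary (d - 2)) :
    offPart N.latticeDualBoundary (boundary (N.domainWalls s)) - N.frustrationChain ∈
      boundaries N.minusDual N.minusDualBoundary (d - 2) := by
  rw [minusDualBoundary_eq]
  refine (mem_boundaries_iff rfl N.unionComplex_isSubcomplex N.plusComplex_isSubcomplex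
    (k := 1) (by omega) (finite_complex _ (by omega))
    (Submodule.sub_mem _ h.1 (N.frustrationChain_mem_cycles hd).1)).2 ?_
  have h1 : dualCochain N.minusCells N.frustrationChain =
      coboundary N.unionComplex (N.violation s) :=
    dualCochain_eq_of_dual rfl (N.coboundary_violation_mem_cocycles s).1
      (N.frustrationChain_apply s)
  -- Under duality the difference of the two chains becomes the coboundary of this cochain.
  have h2 : N.plusComplex.indicator (N.violation s) - N.violation s =
      -N.minusCells.indicator (N.violation s) := by
    rw [sub_eq_iff_eq_add, eq_neg_add_iff_add_eq, add_comm, ← N.violation_eq_add]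
  change dualCochain N.minusCells _ ∈ _
  rw [map_sub, N.dualCochain_offPart_boundary (N.domainWalls_mem_cycles hd s)
    (N.indicator_violation_mem_cocycles s) (N.domainWalls_apply s), h1, ← map_sub, h2]
  exact Submodule.mem_map_of_mem
    (Submodule.neg_mem _ (N.indicator_minusCells_violation_mem_cochains s))

end Networks

end SpinGlass
-- The theorem
open SpinGlass in
theorem theorem5p4 {d : ℕ} (hd : 2 ≤ d) (G : Glass d) (N : Networks G) :
    ∃ (θ : Cohomology N.plusComplex ∅ 1 ≃ₗ[ZMod 2]
          Homology N.plusDual N.plusDualBoundary (d - 1))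
      (ζ : Cohomology N.unionComplex N.plusComplex 2 ≃ₗ[ZMod 2]
          Homology N.minusDual N.minusDualBoundary (d - 2)),
      -- the two vertical maps send a cochain to the chain of the dual cells
      (∀ α (hα : α ∈ cocycles N.plusComplex ∅ 1),
        ∃ (S : Chain d) (hS : S ∈ cycles N.plusDual N.plusDualBoundary (d - 1)),
          (∀ c, S (dual c) = α c) ∧ θ (Subquotient.mk α hα) = Subquotient.mk S hS) ∧
      (∀ η (hη : η ∈ cocycles N.unionComplex N.plusComplex 2),
        ∃ (Γ : Chain d) (hΓ : Γ ∈ cycles N.minusDual N.minusDualBoundary (d - 2)),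
          (∀ c, Γ (dual c) = η c) ∧ ζ (Subquotient.mk η hη) = Subquotient.mk Γ hΓ) ∧
      -- the square commutes
      (∀ x, ζ (N.coboundaryMap x) = N.boundaryMap hd (θ x)) ∧
      -- the boundary of the domain walls of any spin configuration is the class of the complex of
      -- the frustrated plaquettes
      ∀ σ : Cell d → ℤˣ,
        ∃ (hS : N.domainWalls σ ∈ cycles N.plusDual N.plusDualBoundary (d - 1))
          (hΓ : N.frustrationChain ∈ cycles N.minusDual N.minusDualBoundary (d - 2)),
          N.boundaryMap hd (Subquotient.mk _ hS) = Subquotient.mk _ hΓ := by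
  obtain ⟨e₁, he₁⟩ := N.exists_plusEquiv hd
  obtain ⟨e₂, he₂⟩ := N.exists_minusEquiv hd
  -- The equivalences run from homology to cohomology, so the vertical maps are their inverses.
  refine ⟨e₁.symm, e₂.symm, fun α hα => ?_, fun η hη => ?_, fun q => ?_, fun σ => ?_⟩
  · obtain ⟨S, hS, hSα, hdS⟩ := N.exists_plus_cycle hd hα
    refine ⟨S, hS, hSα, ?_⟩
    rw [LinearEquiv.symm_apply_eq, he₁ S hS (by rwa [hdS])]
    exact Subquotient.mk_congr hdS.symm
  · obtain ⟨Γ, hΓ, hΓη, hdΓ⟩ := N.exists_minus_cycle hd hη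
    refine ⟨Γ, hΓ, hΓη, ?_⟩
    rw [LinearEquiv.symm_apply_eq, he₂ Γ hΓ (by rwa [hdΓ])]
    exact Subquotient.mk_congr hdΓ.symm
  · rw [LinearEquiv.symm_apply_eq]
    exact N.boundaryMap_comm hd he₁ he₂ q
  · have hS := N.domainWalls_mem_cycles hd σ
    obtain ⟨h, hb⟩ := N.boundaryMap_mk hd hS
    refine ⟨hS, N.frustrationChain_mem_cycles hd, hb.trans ?_⟩
    exact Subquotient.mk_eq_mk.2 (N.offPart_boundary_sub_frustrationChain_mem hd σ h)
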